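/- For a polynomial $P$ of degree $n$ and $a\in\mathbb{C}$ with $|a|\le 1$ let $\tilde S_a[P](z)=(1+az)P'(z)-naP(z)$ be the modified Smirnov operator, and for $R\ge 1$ let $\tilde S_a[P](Rz)$ denote the operator applied to the polynomial $z\mapsto P(Rz)$, i.e. $(1+az)\,R\,P'(Rz)-naP(Rz)$. Let $\alpha,\beta\in\mathbb{C}$ with $|\alpha|\le1$, $|\beta|\le1$, let $R\ge1$ be real, and put $$A=\Bigl|R^n-\alpha+\beta\Bigl\{\Bigl(\tfrac{R+1}{2}\Bigr)^n-|\alpha|\Bigr\}\Bigr|,\qquad B=\Bigl|1-\alpha+\beta\Bigl\{\Bigl(\tfrac{R+1}{2}\Bigr)^n-|\alpha|\Bigr\}\Bigr|.$$ If $P$ is a polynomial of degree $n$ with no zeros in the open unit disk and $|a|\le 1$, then for all $z\in\mathbb{C}$ with $|z|\ge1$ $$\Bigl|\tilde S_a[P](Rz)-\alpha\tilde S_a[P](z)+\beta\Bigl\{\Bigl(\tfrac{R+1}{2}\Bigr)^n-|\alpha|\Bigr\}\tilde S_a[P](z)\Bigr|\le\frac12\Bigl[\bigl(A|\tilde S_a[z^n]|+Bn|a|\bigr)\max_{|w|=1}|P(w)|-\bigl(A|\tilde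 S_a[z^n]|-Bn|a|\bigr)\min_{|w|=1}|P(w)|\Bigr].$$ Equality is attained for $P(z)=z^n+1$, in the following sense: for all $n,\alpha,\beta,R$ as above, every $z$ with $|z|\ge1$ and every $\rho\in[0,1]$ there is an $a$ with $|a|=\rho$ for which equality holds at $z$; and if $n\ge2$, then for every $a$ with $|a|\le1$ and every $r\ge1$ there is a $z$ with $|z|=r$ at which equality holds. -/

import Mathlib

open Polynomial

noncomputable section

namespace Smirnov

/-- The modified Smirnov operator on polynomials of degree `n`:
`S̃_a[P](z) = (1 + a z) P'(z) - n a P(z)`. -/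
def smirnov (n : ℕ) (a : ℂ) (P : ℂ[X]) : ℂ[X] :=
  (1 + C a * X) * derivative P - C ((n : ℂ) * a) * P

/-- The polynomial `z ↦ P(Rz)`. -/
def dilate (R : ℝ) (P : ℂ[X]) : ℂ[X] := P.comp (C (R : ℂ) * X)

/-- The maximum of `|P|` on the unit circle. -/
def maxModulus (P : ℂ[X]) : ℝ := sSup ((fun z : ℂ => ‖P.eval z‖) '' Metric.sphere 0 1)

/-- The minimum of `|P|` on the unit circle. -/
def minModulus (P : ℂ[X]) : ℝ := sInf ((fun z : ℂ => ‖P.eval z‖) '' Metric.sphere 0 1)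

theorem maxModulus_isGreatest (P : ℂ[X]) :
    IsGreatest ((fun z : ℂ => ‖P.eval z‖) '' Metric.sphere 0 1) (maxModulus P) :=
  ((isCompact_sphere (0 : ℂ) 1).image (by fun_prop)).isGreatest_sSup
    ((NormedSpace.sphere_nonempty.2 zero_le_one).image _)

theorem minModulus_isLeast (P : ℂ[X]) :
    IsLeast ((fun z : ℂ => ‖P.eval z‖) '' Metric.sphere 0 1) (minModulus P) :=
  ((isCompact_sphere (0 : ℂ) 1).image (by fun_prop)).isLeast_sInf
    ((NormedSpace.sphere_nonempty.2 zero_le_one).image _)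

/-- The real number `((R+1)/2)^n - |α|`. -/
def gap (n : ℕ) (α : ℂ) (R : ℝ) : ℝ := ((R + 1) / 2) ^ n - ‖α‖

/-- `S̃_a[P](Rz) - α S̃_a[P](z) + β {((R+1)/2)^n - |α|} S̃_a[P](z)`, where `S̃_a[P](Rz)`
stands for the operator applied to the polynomial `z ↦ P(Rz)`, that is,
`(1 + a z) R P'(Rz) - n a P(Rz)`. -/
def combination (n : ℕ) (a α β : ℂ) (R : ℝ) (P : ℂ[X]) (z : ℂ) : ℂ :=
  (smirnov n a (dilate R P)).eval z - α * (smirnov n a P).eval z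
    + β * (gap n α R : ℂ) * (smirnov n a P).eval z

/-- `A = |R^n - α + β {((R+1)/2)^n - |α|}|`. -/
def coeffA (n : ℕ) (α β : ℂ) (R : ℝ) : ℝ := ‖(R : ℂ) ^ n - α + β * (gap n α R : ℂ)‖

/-- `B = |1 - α + β {((R+1)/2)^n - |α|}|`. -/
def coeffB (n : ℕ) (α β : ℂ) (R : ℝ) : ℝ := ‖1 - α + β * (gap n α R : ℂ)‖

/-- `½ [(A |S̃_a[z^n]| + B n |a|) max |P| - (A |S̃_a[z^n]| - B n |a|) min |P|]`, with the maximum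
and the minimum over the unit circle. -/
def bound (n : ℕ) (a α β : ℂ) (R : ℝ) (P : ℂ[X]) (z : ℂ) : ℝ :=
  1 / 2 *
    ((coeffA n α β R * ‖(smirnov n a (X ^ n)).eval z‖ + coeffB n α β R * n * ‖a‖) * maxModulus P
      - (coeffA n α β R * ‖(smirnov n a (X ^ n)).eval z‖ - coeffB n α β R * n * ‖a‖)
        * minModulus P)

end Smirnov

end

open Filter Topology

namespace Smirnov

/-! With `lam = α - β * gap`, the combination is `T[P] = S̃_a[P(R ·) - lam P]`, linear in `P`, and
`|lam| ≤ ((R+1)/2)^n`. The core is a domination principle (`norm_opValue_le`): if `G` has exact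
degree `n` and all zeros in the closed disk, `deg F ≤ n` and `|F| ≤ |G|` on the circle, then `|T[F]|
≤ |T[G]|` for `|z| ≥ 1`. For `|μ| > 1` the zeros of `F - μG` stay in the closed disk. Both `G ↦ G(R
·) - lam G` and `S̃_a` keep them there, apart from degenerate cases settled directly or by a limit,
so `T[F] = μ T[G]` is impossible. Let `Q` be the conjugate reciprocal of `P`, and `m`, `M` the
minimum and maximum of `|P|` on the circle. Applying domination to `P - μ`, with `|μ| = s` near `m`
or `M` and the phase of `μ` chosen well, gives `|T[P]| ≤ s|T[1]| + | |T[Q]| - s|T[z^n]| |`. Since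
`m|T[z^n]| ≤ |T[Q]| ≤ M|T[z^n]|`, adding the cases `s = m` and `s = M` cancels `|T[Q]|` and leaves
the bound. For `z^n + 1` the bound is `|T[z^n]| + |T[1]|`, so equality only requires aligned phases.
-/

/-- `G` has degree `n` and all its zeros lie in the closed unit disk. -/
def RootsInDisc (n : ℕ) (G : ℂ[X]) : Prop :=
  G.natDegree = n ∧ ∀ z : ℂ, 1 < ‖z‖ → G.eval z ≠ 0

/-! ### Comparison of two polynomials on the disk and on its exterior -/

theorem exists_seq_sphere_tendsto (w : ℂ) (hw : ‖w‖ = 1) :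
    ∃ u : ℕ → ℂ, (∀ k, ‖u k‖ = 1) ∧ (∀ k, u k ≠ w) ∧ Tendsto u atTop (𝓝 w) := by
  have hw0 : w ≠ 0 := by
    rintro rfl
    simp at hw
  refine ⟨fun k => w * Complex.exp (((1 / ((k : ℝ) + 1) : ℝ) : ℂ) * Complex.I), fun k => ?_,
    fun k h => ?_, ?_⟩
  · simp only [norm_mul, hw, Complex.norm_exp_ofReal_mul_I, mul_one]
  · have h1 : Complex.exp (((1 / ((k : ℝ) + 1) : ℝ) : ℂ) * Complex.I) = 1 := by
      simpa [hw0] using h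
    have h2 := congrArg Complex.re h1
    rw [Complex.exp_ofReal_mul_I_re, Complex.one_re] at h2
    have hpos : 0 < 1 / ((k : ℝ) + 1) := by positivity
    have hle : 1 / ((k : ℝ) + 1) ≤ 1 := by
      rw [div_le_one (by positivity)]
      linarith [Nat.cast_nonneg (α := ℝ) k]
    have := (Real.cos_eq_one_iff_of_lt_of_lt (by linarith [Real.pi_gt_three])
      (by linarith [Real.pi_gt_three])).1 h2
    linarith
  · have h0 : Tendsto (fun k : ℕ => 1 / ((k : ℝ) + 1)) atTop (𝓝 0) :=
      tendsto_one_div_add_atTop_nhds_zero_nat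
    have hc : Continuous fun t : ℝ => w * Complex.exp ((t : ℂ) * Complex.I) := by fun_prop
    have := (hc.tendsto 0).comp h0
    simpa [Function.comp_def] using this

/-- The maximum principle for `F / G`. Zeros of `G` on the circle are also zeros of `F`, and are
cancelled one at a time by induction on the degree. -/
theorem norm_eval_le_of_sphere (F G : ℂ[X]) (hG : ∀ z : ℂ, ‖z‖ < 1 → G.eval z ≠ 0)
    (h : ∀ z : ℂ, ‖z‖ = 1 → ‖F.eval z‖ ≤ ‖G.eval z‖) (z : ℂ) (hz : ‖z‖ ≤ 1) :
    ‖F.eval z‖ ≤ ‖G.eval z‖ := by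
  induction hd : G.natDegree using Nat.strong_induction_on generalizing F G with
  | _ d ih =>
  have hG0 : G ≠ 0 := by
    rintro rfl
    exact hG 0 (by simp) (by simp)
  by_cases hw : ∃ w : ℂ, ‖w‖ = 1 ∧ G.eval w = 0
  · obtain ⟨w, hw1, hGw⟩ := hw
    have hFw : F.eval w = 0 := by
      have := h w hw1
      rw [hGw, norm_zero] at this
      exact norm_le_zero_iff.1 this
    obtain ⟨F₁, rfl⟩ := dvd_iff_isRoot.2 hFw
    obtain ⟨G₁, rfl⟩ := dvd_iff_isRoot.2 hGw
    have hG₁ : G₁ ≠ 0 := right_ne_zero_of_mul hG0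
    rw [natDegree_mul (X_sub_C_ne_zero w) hG₁, natDegree_X_sub_C] at hd
    have key : ‖F₁.eval z‖ ≤ ‖G₁.eval z‖ := by
      have hne : ∀ y : ℂ, ‖y‖ = 1 → y ≠ w → ‖F₁.eval y‖ ≤ ‖G₁.eval y‖ := by
        intro y hy hyw
        have := h y hy
        simp only [eval_mul, eval_sub, eval_X, eval_C, norm_mul] at this
        exact le_of_mul_le_mul_left this (norm_pos_iff.2 (sub_ne_zero.2 hyw))
      refine ih _ (by omega) F₁ G₁ (fun y hy h0 => hG y hy (by simp [h0])) (fun y hy => ?_) rfl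
      -- At the cancelled zero the inequality is recovered by continuity along the circle.
      by_cases hyw : y = w
      · subst hyw
        obtain ⟨u, hu1, hu2, hu⟩ := exists_seq_sphere_tendsto y hy
        exact le_of_tendsto_of_tendsto'
          (((F₁.continuous.norm).tendsto y).comp hu) (((G₁.continuous.norm).tendsto y).comp hu)
          fun k => hne _ (hu1 k) (hu2 k)
      · exact hne y hy hyw
    simp only [eval_mul, norm_mul]
    gcongr
  · push Not at hw
    have hne : ∀ y : ℂ, ‖y‖ ≤ 1 → G.eval y ≠ 0 := fun y hy =>
      hy.lt_or_eq.elim (hG y) (hw y)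
    have hdiff : DiffContOnCl ℂ (fun y => F.eval y / G.eval y) (Metric.ball (0 : ℂ) 1) := by
      apply DifferentiableOn.diffContOnCl
      rw [closure_ball _ one_ne_zero]
      intro y hy
      exact (F.differentiable.differentiableAt.div G.differentiable.differentiableAt
        (hne y (by simpa using hy))).differentiableWithinAt
    have := Complex.norm_le_of_forall_mem_frontier_norm_le Metric.isBounded_ball hdiff (C := 1)
      (fun y hy => by
        rw [frontier_ball _ one_ne_zero, mem_sphere_zero_iff_norm] at hy
        rw [norm_div]
        exact div_le_one_of_le₀ (h y hy) (norm_nonneg _))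
      (z := z) (by rw [closure_ball _ one_ne_zero]; simpa using hz)
    rw [norm_div, div_le_one (norm_pos_iff.2 (hne z hz))] at this
    exact this

theorem eval_reflect_inv {n : ℕ} {F : ℂ[X]} (hF : F.natDegree ≤ n) {z : ℂ} (hz : z ≠ 0) :
    (reflect n F).eval z⁻¹ * z ^ n = F.eval z := by
  let := invertibleOfNonzero hz
  have := eval₂_reflect_mul_pow (RingHom.id ℂ) z n F hF
  simpa [eval₂_id, invOf_eq_inv] using this

theorem eval_reflect {n : ℕ} {F : ℂ[X]} (hF : F.natDegree ≤ n) {z : ℂ} (hz : z ≠ 0) :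
    (reflect n F).eval z = F.eval z⁻¹ * z ^ n := by
  rw [← eval_reflect_inv hF (inv_ne_zero hz), inv_inv, mul_assoc, ← mul_pow, inv_mul_cancel₀ hz,
    one_pow, mul_one]

theorem RootsInDisc.coeff_ne_zero {n : ℕ} {G : ℂ[X]} (hG : RootsInDisc n G) : G.coeff n ≠ 0 := by
  rw [← hG.1]
  have : G ≠ 0 := by
    rintro rfl
    exact hG.2 2 (by simp) (by simp)
  simpa using this

theorem norm_eval_reflect_le {n : ℕ} {F G : ℂ[X]} (hF : F.natDegree ≤ n) (hG : RootsInDisc n G)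
    (h : ∀ z : ℂ, ‖z‖ = 1 → ‖F.eval z‖ ≤ ‖G.eval z‖) (z : ℂ) (hz : ‖z‖ ≤ 1) :
    ‖(reflect n F).eval z‖ ≤ ‖(reflect n G).eval z‖ := by
  refine norm_eval_le_of_sphere _ _ (fun y hy => ?_) (fun y hy => ?_) z hz
  · by_cases hy0 : y = 0
    · subst hy0
      rw [← coeff_zero_eq_eval_zero, coeff_reflect, revAt_zero]
      exact hG.coeff_ne_zero
    · rw [eval_reflect hG.1.le hy0]
      refine mul_ne_zero (hG.2 _ ?_) (pow_ne_zero _ hy0)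
      rw [norm_inv]
      exact (one_lt_inv₀ (norm_pos_iff.2 hy0)).2 hy
  · have hy0 : y ≠ 0 := by
      rintro rfl
      simp at hy
    rw [eval_reflect hF hy0, eval_reflect hG.1.le hy0, norm_mul, norm_mul]
    gcongr
    exact h _ (by rw [norm_inv, hy, inv_one])

theorem norm_eval_le_exterior {n : ℕ} {F G : ℂ[X]} (hF : F.natDegree ≤ n) (hG : RootsInDisc n G)
    (h : ∀ z : ℂ, ‖z‖ = 1 → ‖F.eval z‖ ≤ ‖G.eval z‖) (z : ℂ) (hz : 1 ≤ ‖z‖) :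
    ‖F.eval z‖ ≤ ‖G.eval z‖ := by
  have hz0 : z ≠ 0 := norm_pos_iff.1 (by linarith)
  rw [← eval_reflect_inv hF hz0, ← eval_reflect_inv hG.1.le hz0, norm_mul, norm_mul]
  gcongr
  exact norm_eval_reflect_le hF hG h _ (by rw [norm_inv]; exact inv_le_one_of_one_le₀ hz)

/-- The exterior comparison at infinity, read off from the reflected polynomials at `0`. -/
theorem norm_coeff_le {n : ℕ} {F G : ℂ[X]} (hF : F.natDegree ≤ n) (hG : RootsInDisc n G)
    (h : ∀ z : ℂ, ‖z‖ = 1 → ‖F.eval z‖ ≤ ‖G.eval z‖) : ‖F.coeff n‖ ≤ ‖G.coeff n‖ := by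
  have := norm_eval_reflect_le hF hG h 0 (by simp)
  simpa only [← coeff_zero_eq_eval_zero, coeff_reflect, revAt_zero] using this

theorem sub_mul_ne_zero_of_norm_le {u v μ : ℂ} (h : ‖u‖ ≤ ‖v‖) (hv : v ≠ 0) (hμ : 1 < ‖μ‖) :
    u - μ * v ≠ 0 := by
  intro h0
  rw [sub_eq_zero.1 h0, norm_mul] at h
  have := norm_pos_iff.2 hv
  nlinarith

theorem RootsInDisc.sub_C_mul {n : ℕ} {F G : ℂ[X]} (hF : F.natDegree ≤ n) (hG : RootsInDisc n G)
    (h : ∀ z : ℂ, ‖z‖ = 1 → ‖F.eval z‖ ≤ ‖G.eval z‖) {μ : ℂ} (hμ : 1 < ‖μ‖) :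
    RootsInDisc n (F - C μ * G) := by
  constructor
  · refine natDegree_eq_of_le_of_coeff_ne_zero
      ((natDegree_sub_le _ _).trans (max_le hF ((natDegree_C_mul_le _ _).trans hG.1.le))) ?_
    rw [coeff_sub, coeff_C_mul]
    exact sub_mul_ne_zero_of_norm_le (norm_coeff_le hF hG h) hG.coeff_ne_zero hμ
  · intro z hz
    rw [eval_sub, eval_mul, eval_C]
    exact sub_mul_ne_zero_of_norm_le (norm_eval_le_exterior hF hG h z hz.le) (hG.2 z hz) hμ

/-! ### Growth under dilation -/

/-- The difference of the squares is `(R - 1)/4` times the expression in `h4`; Cauchy–Schwarz bounds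
the latter below by the product in `hfac`. -/
theorem mul_norm_sub_lt_norm_mul_sub {R : ℝ} (hR : 1 < R) {z w : ℂ} (hz : 1 < ‖z‖)
    (hw : ‖w‖ ≤ 1) : (R + 1) / 2 * ‖z - w‖ < ‖(R : ℂ) * z - w‖ := by
  refine lt_of_pow_lt_pow_left₀ 2 (norm_nonneg _) ?_
  have h1 : z.re ^ 2 + z.im ^ 2 = ‖z‖ ^ 2 := by
    rw [Complex.sq_norm, Complex.normSq_apply]; ring
  have h2 : w.re ^ 2 + w.im ^ 2 = ‖w‖ ^ 2 := by
    rw [Complex.sq_norm, Complex.normSq_apply]; ring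
  have h3 : -(‖z‖ * ‖w‖) ≤ z.re * w.re + z.im * w.im := by
    refine neg_le_of_abs_le (abs_le_of_sq_le_sq ?_ (by positivity))
    rw [mul_pow, ← h1, ← h2]
    nlinarith [sq_nonneg (z.re * w.im - z.im * w.re)]
  rw [mul_pow, Complex.sq_norm, Complex.sq_norm, Complex.normSq_apply, Complex.normSq_apply]
  simp only [Complex.sub_re, Complex.sub_im, Complex.mul_re, Complex.mul_im, Complex.ofReal_re,
    Complex.ofReal_im]
  have hfac : 0 < (‖z‖ - ‖w‖) * ((3 * R + 1) * ‖z‖ + (R + 3) * ‖w‖) := by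
    have := norm_nonneg w
    apply mul_pos (by linarith)
    nlinarith
  have h4 : 0 < (3 * R + 1) * (z.re ^ 2 + z.im ^ 2) - (R + 3) * (w.re ^ 2 + w.im ^ 2)
      + 2 * (R - 1) * (z.re * w.re + z.im * w.im) := by
    rw [h1, h2]
    nlinarith
  nlinarith [mul_pos (sub_pos.2 hR) h4]

theorem pow_card_mul_norm_prod_lt {R : ℝ} (hR : 1 < R) {z : ℂ} (hz : 1 < ‖z‖) (s : Multiset ℂ)
    (hs : ∀ w ∈ s, ‖w‖ ≤ 1) :
    0 < ‖(s.map (z - ·)).prod‖ ∧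
    ((R + 1) / 2) ^ s.card * ‖(s.map (z - ·)).prod‖ ≤ ‖(s.map ((R : ℂ) * z - ·)).prod‖ ∧
    (s ≠ 0 →
      ((R + 1) / 2) ^ s.card * ‖(s.map (z - ·)).prod‖ < ‖(s.map ((R : ℂ) * z - ·)).prod‖) := by
  induction s using Multiset.induction with
  | empty => simp
  | cons w s ih =>
    obtain ⟨h0, h1, -⟩ := ih fun v hv => hs v (Multiset.mem_cons_of_mem hv)
    have hw := hs w (Multiset.mem_cons_self w s)
    have hlt := mul_norm_sub_lt_norm_mul_sub hR hz hw
    have hzw : 0 < ‖z - w‖ := by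
      have := norm_sub_norm_le z w
      linarith
    simp only [Multiset.map_cons, Multiset.prod_cons, Multiset.card_cons, norm_mul]
    have hR0 : 0 < (R + 1) / 2 := by linarith
    have hstrict : ((R + 1) / 2) ^ (s.card + 1) * (‖z - w‖ * ‖(s.map (z - ·)).prod‖)
        < ‖(R : ℂ) * z - w‖ * ‖(s.map ((R : ℂ) * z - ·)).prod‖ := by
      calc _ = ((R + 1) / 2 * ‖z - w‖) * (((R + 1) / 2) ^ s.card * ‖(s.map (z - ·)).prod‖) := by
            ring
        _ < ‖(R : ℂ) * z - w‖ * (((R + 1) / 2) ^ s.card * ‖(s.map (z - ·)).prod‖) := by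
            gcongr
        _ ≤ _ := by gcongr
    exact ⟨mul_pos hzw h0, hstrict.le, fun _ => hstrict⟩

theorem RootsInDisc.norm_le_one_of_mem_roots {n : ℕ} {G : ℂ[X]} (hG : RootsInDisc n G) {w : ℂ}
    (hw : w ∈ G.roots) : ‖w‖ ≤ 1 := by
  by_contra! h
  exact hG.2 w h (isRoot_of_mem_roots hw)

theorem RootsInDisc.card_roots {n : ℕ} {G : ℂ[X]} (hG : RootsInDisc n G) : G.roots.card = n := by
  rw [← (IsAlgClosed.splits G).natDegree_eq_card_roots, hG.1]

theorem RootsInDisc.mul_norm_eval_lt {n : ℕ} (hn : n ≠ 0) {G : ℂ[X]} (hG : RootsInDisc n G)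
    {R : ℝ} (hR : 1 < R) {z : ℂ} (hz : 1 < ‖z‖) :
    ((R + 1) / 2) ^ n * ‖G.eval z‖ < ‖G.eval ((R : ℂ) * z)‖ := by
  have hlt := (pow_card_mul_norm_prod_lt hR hz G.roots
    fun w hw => hG.norm_le_one_of_mem_roots hw).2.2 (by
      intro h
      have := hG.card_roots
      simp [h] at this
      exact hn this.symm)
  rw [hG.card_roots] at hlt
  rw [(IsAlgClosed.splits G).eval_eq_prod_roots, (IsAlgClosed.splits G).eval_eq_prod_roots,
    norm_mul, norm_mul, mul_left_comm]
  have hlc : 0 < ‖G.leadingCoeff‖ := by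
    have := hG.coeff_ne_zero
    rw [← hG.1] at this
    exact norm_pos_iff.2 this
  gcongr

theorem eval_dilate (R : ℝ) (P : ℂ[X]) (z : ℂ) : (dilate R P).eval z = P.eval ((R : ℂ) * z) := by
  simp [dilate]

theorem eval_derivative_dilate (R : ℝ) (P : ℂ[X]) (z : ℂ) :
    (derivative (dilate R P)).eval z = R * (derivative P).eval ((R : ℂ) * z) := by
  simp [dilate, derivative_comp]

theorem natDegree_dilate_le (R : ℝ) (P : ℂ[X]) : (dilate R P).natDegree ≤ P.natDegree := by
  refine natDegree_comp_le.trans ?_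
  exact (Nat.mul_le_mul_left _ ((natDegree_C_mul_le _ _).trans natDegree_X_le)).trans_eq (mul_one _)

theorem coeff_dilate (R : ℝ) (P : ℂ[X]) (k : ℕ) :
    (dilate R P).coeff k = P.coeff k * (R : ℂ) ^ k := by
  rw [dilate, comp_C_mul_X_coeff]

/-- For `R > 1`, outside the disk `|G(Rz)|` strictly exceeds `((R+1)/2)^n |G(z)|`, and the leading
factor `R^n - lam` is nonzero because `R > (R+1)/2`. The excluded case gives the zero polynomial. -/
theorem RootsInDisc.dilate_sub {n : ℕ} (hn : n ≠ 0) {G : ℂ[X]} (hG : RootsInDisc n G)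
    {R : ℝ} (hR : 1 ≤ R) {lam : ℂ} (hlam : ‖lam‖ ≤ ((R + 1) / 2) ^ n)
    (hne : ¬ (R = 1 ∧ lam = 1)) : RootsInDisc n (dilate R G - C lam * G) := by
  rcases hR.eq_or_lt with rfl | hR1
  · have hlam1 : 1 - lam ≠ 0 := fun h => hne ⟨rfl, (sub_eq_zero.1 h).symm⟩
    have : dilate 1 G - C lam * G = C (1 - lam) * G := by
      simp [dilate, sub_mul]
    rw [this]
    refine ⟨by rw [natDegree_C_mul hlam1, hG.1], fun z hz => ?_⟩
    rw [eval_mul, eval_C]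
    exact mul_ne_zero hlam1 (hG.2 z hz)
  · constructor
    · refine natDegree_eq_of_le_of_coeff_ne_zero ((natDegree_sub_le _ _).trans
        (max_le ((natDegree_dilate_le _ _).trans hG.1.le)
          ((natDegree_C_mul_le _ _).trans hG.1.le))) ?_
      rw [coeff_sub, coeff_C_mul, coeff_dilate, mul_comm, ← sub_mul]
      refine mul_ne_zero (fun h => ?_) hG.coeff_ne_zero
      rw [← sub_eq_zero.1 h, norm_pow, Complex.norm_real, Real.norm_of_nonneg (by linarith)] at hlam
      exact absurd hlam (not_le.2 (pow_lt_pow_left₀ (by linarith) (by linarith) hn))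
    · intro z hz h
      have hlt := hG.mul_norm_eval_lt hn hR1 hz
      rw [eval_sub, eval_mul, eval_C, eval_dilate, sub_eq_zero] at h
      rw [h, norm_mul] at hlt
      exact absurd hlt (not_lt.2 (by gcongr))

/-! ### The Smirnov operator preserves the location of the zeros -/

theorem eval_smirnov (n : ℕ) (a : ℂ) (P : ℂ[X]) (z : ℂ) :
    (smirnov n a P).eval z = (1 + a * z) * (derivative P).eval z - n * a * P.eval z := by
  simp [smirnov]

/-- The map `w ↦ (1 + a w)/(z - w)` sends the closed unit disk into the disk with centre `ξ/(|z|² -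
1)` and radius `|1 + a z|/(|z|² - 1)`. The radius is smaller than the modulus of the centre, as
`|ξ|² - |1 + a z|² = (|z|² - 1)(1 - |a|²)`, so the image lies in an open half-plane bounded by a
line through `0`. -/
theorem re_mobius_mul_conj_pos {a z w : ℂ} (ha : ‖a‖ < 1) (hz : 1 < ‖z‖) (hw : ‖w‖ ≤ 1) :
    0 < ((1 + a * w) / (z - w) * (starRingEnd ℂ) ((starRingEnd ℂ) z + a)).re := by
  set ξ := (starRingEnd ℂ) z + a with hξ
  have hzw : z - w ≠ 0 := by
    intro h
    rw [sub_eq_zero.1 h] at hz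
    linarith
  have hzz : (starRingEnd ℂ) z * z = ((‖z‖ ^ 2 : ℝ) : ℂ) := by
    rw [mul_comm, Complex.mul_conj, Complex.sq_norm]
  have hid : (1 + a * w) / (z - w) * ((‖z‖ ^ 2 - 1 : ℝ) : ℂ) - ξ
      = (1 + a * z) * (((starRingEnd ℂ) z * w - 1) / (z - w)) := by
    field_simp
    rw [Complex.ofReal_sub, ← hzz, hξ, Complex.ofReal_one]
    ring
  have h1 : z.re ^ 2 + z.im ^ 2 = ‖z‖ ^ 2 := by
    rw [Complex.sq_norm, Complex.normSq_apply]; ring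
  have h2 : w.re ^ 2 + w.im ^ 2 = ‖w‖ ^ 2 := by
    rw [Complex.sq_norm, Complex.normSq_apply]; ring
  have h3 : a.re ^ 2 + a.im ^ 2 = ‖a‖ ^ 2 := by
    rw [Complex.sq_norm, Complex.normSq_apply]; ring
  have hzw1 : ‖((starRingEnd ℂ) z * w - 1) / (z - w)‖ ≤ 1 := by
    rw [norm_div]
    refine div_le_one_of_le₀ (le_of_sq_le_sq ?_ (norm_nonneg _)) (norm_nonneg _)
    have : 0 ≤ (‖z‖ ^ 2 - 1) * (1 - ‖w‖ ^ 2) :=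
      mul_nonneg (by nlinarith) (by nlinarith [norm_nonneg w])
    rw [← h1, ← h2] at this
    rw [Complex.sq_norm, Complex.sq_norm, Complex.normSq_apply, Complex.normSq_apply]
    simp
    nlinarith
  have hlt : ‖1 + a * z‖ < ‖ξ‖ := by
    refine lt_of_pow_lt_pow_left₀ 2 (norm_nonneg _) ?_
    have : 0 < (‖z‖ ^ 2 - 1) * (1 - ‖a‖ ^ 2) :=
      mul_pos (by nlinarith) (by nlinarith [norm_nonneg a])
    rw [← h1, ← h3] at this
    rw [Complex.sq_norm, Complex.sq_norm, Complex.normSq_apply, Complex.normSq_apply, hξ]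
    simp
    nlinarith
  set v := (1 + a * w) / (z - w) with hv
  have hD : 0 < ‖z‖ ^ 2 - 1 := by nlinarith
  have hle : ‖v * ((‖z‖ ^ 2 - 1 : ℝ) : ℂ) - ξ‖ < ‖ξ‖ := by
    rw [hid, norm_mul]
    nlinarith [norm_nonneg (1 + a * z)]
  have hre := Complex.abs_re_le_norm ((v * ((‖z‖ ^ 2 - 1 : ℝ) : ℂ) - ξ) * (starRingEnd ℂ) ξ)
  rw [norm_mul, Complex.norm_conj] at hre
  have hexp : ((v * ((‖z‖ ^ 2 - 1 : ℝ) : ℂ) - ξ) * (starRingEnd ℂ) ξ).re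
      = (‖z‖ ^ 2 - 1) * (v * (starRingEnd ℂ) ξ).re - ‖ξ‖ ^ 2 := by
    have : (v * ((‖z‖ ^ 2 - 1 : ℝ) : ℂ) - ξ) * (starRingEnd ℂ) ξ
        = ((‖z‖ ^ 2 - 1 : ℝ) : ℂ) * (v * (starRingEnd ℂ) ξ) - ((‖ξ‖ ^ 2 : ℝ) : ℂ) := by
      rw [sub_mul, Complex.mul_conj, ← Complex.sq_norm]
      ring
    rw [this, Complex.sub_re, Complex.re_ofReal_mul, Complex.ofReal_re]
  rw [hexp] at hre
  have hξ0 : 0 < ‖ξ‖ := (norm_nonneg _).trans_lt hlt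
  have := neg_le_of_abs_le hre
  have : 0 < (‖z‖ ^ 2 - 1) * (v * (starRingEnd ℂ) ξ).re := by nlinarith
  exact pos_of_mul_pos_right this hD.le

theorem re_sum_map_mobius_pos {a z : ℂ} (ha : ‖a‖ < 1) (hz : 1 < ‖z‖) (s : Multiset ℂ)
    (hs : ∀ w ∈ s, ‖w‖ ≤ 1) :
    0 ≤ (((s.map fun w => (1 + a * w) / (z - w)).sum)
      * (starRingEnd ℂ) ((starRingEnd ℂ) z + a)).re ∧
    (s ≠ 0 → 0 < (((s.map fun w => (1 + a * w) / (z - w)).sum)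
      * (starRingEnd ℂ) ((starRingEnd ℂ) z + a)).re) := by
  induction s using Multiset.induction with
  | empty => simp
  | cons w s ih =>
    have h0 := (ih fun v hv => hs v (Multiset.mem_cons_of_mem hv)).1
    have hw := re_mobius_mul_conj_pos ha hz (hs w (Multiset.mem_cons_self w s))
    have hpos := add_pos_of_pos_of_nonneg hw h0
    rw [← Complex.add_re, ← add_mul] at hpos
    rw [Multiset.map_cons, Multiset.sum_cons]
    exact ⟨hpos.le, fun _ => hpos⟩

theorem sum_map_mobius {a z : ℂ} (s : Multiset ℂ) (hs : ∀ w ∈ s, z - w ≠ 0) :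
    (s.map fun w => (1 + a * w) / (z - w)).sum
      = (1 + a * z) * (s.map fun w => 1 / (z - w)).sum - s.card * a := by
  induction s using Multiset.induction with
  | empty => simp
  | cons w s ih =>
    have hw := hs w (Multiset.mem_cons_self w s)
    simp only [Multiset.map_cons, Multiset.sum_cons, Multiset.card_cons]
    rw [ih fun v hv => hs v (Multiset.mem_cons_of_mem hv)]
    push_cast
    field_simp
    ring

/-- By the logarithmic derivative, `S̃_a[G]/G` is the sum of `(1 + a w)/(z - w)` over the roots. All
terms lie in one open half-plane, so the sum cannot vanish. -/
theorem RootsInDisc.eval_smirnov_ne_zero {n : ℕ} (hn : n ≠ 0) {G : ℂ[X]} (hG : RootsInDisc n G)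
    {a z : ℂ} (ha : ‖a‖ < 1) (hz : 1 < ‖z‖) : (smirnov n a G).eval z ≠ 0 := by
  have hGz := hG.2 z hz
  have hroots : ∀ w ∈ G.roots, z - w ≠ 0 := by
    intro w hw h
    have := hG.norm_le_one_of_mem_roots hw
    rw [← sub_eq_zero.1 h] at this
    linarith
  have hsum : (smirnov n a G).eval z
      = G.eval z * (G.roots.map fun w => (1 + a * w) / (z - w)).sum := by
    rw [sum_map_mobius _ hroots,
      ← (IsAlgClosed.splits G).eval_derivative_div_eval_of_ne_zero hGz, hG.card_roots,
      eval_smirnov]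
    field_simp
  rw [hsum]
  refine mul_ne_zero hGz fun h => ?_
  have := (re_sum_map_mobius_pos ha hz G.roots
    fun w hw => hG.norm_le_one_of_mem_roots hw).2 (by
      intro h
      have := hG.card_roots
      simp [h] at this
      exact hn this.symm)
  simp [h] at this

/-! ### The operator `P ↦ S̃_a[P(R ·) - lam P]` -/

/-- The value at `z` of the modified Smirnov operator applied to `P(R ·) - lam P`. -/
noncomputable def opValue (n : ℕ) (a lam : ℂ) (R : ℝ) (P : ℂ[X]) (z : ℂ) : ℂ :=
  (smirnov n a (dilate R P - C lam * P)).eval z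

theorem opValue_eq (n : ℕ) (a lam : ℂ) (R : ℝ) (P : ℂ[X]) (z : ℂ) :
    opValue n a lam R P z
      = (1 + a * z) * (R * (derivative P).eval ((R : ℂ) * z) - lam * (derivative P).eval z)
        - n * a * (P.eval ((R : ℂ) * z) - lam * P.eval z) := by
  rw [opValue, eval_smirnov]
  simp [eval_dilate, eval_derivative_dilate]

theorem opValue_sub_C_mul (n : ℕ) (a lam : ℂ) (R : ℝ) (F G : ℂ[X]) (μ z : ℂ) :
    opValue n a lam R (F - C μ * G) z = opValue n a lam R F z - μ * opValue n a lam R G z := by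
  simp only [opValue_eq, derivative_sub, derivative_C_mul, eval_sub, eval_mul, eval_C]
  ring

theorem opValue_C_mul (n : ℕ) (a lam : ℂ) (R : ℝ) (G : ℂ[X]) (μ z : ℂ) :
    opValue n a lam R (C μ * G) z = μ * opValue n a lam R G z := by
  simp only [opValue_eq, derivative_C_mul, eval_mul, eval_C]
  ring

theorem opValue_one (n : ℕ) (a lam : ℂ) (R : ℝ) (z : ℂ) :
    opValue n a lam R 1 z = -(n * a * (1 - lam)) := by
  simp [opValue_eq]

theorem opValue_X_pow (n : ℕ) (a lam : ℂ) (R : ℝ) (z : ℂ) :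
    opValue n a lam R (X ^ n) z = ((R : ℂ) ^ n - lam) * (n * z ^ (n - 1)) := by
  rw [opValue_eq]
  cases n with
  | zero => simp
  | succ k =>
    simp
    ring

theorem combination_eq_opValue (n : ℕ) (a α β : ℂ) (R : ℝ) (P : ℂ[X]) (z : ℂ) :
    combination n a α β R P z = opValue n a (α - β * (gap n α R : ℂ)) R P z := by
  rw [combination, opValue_eq, eval_smirnov, eval_smirnov, eval_dilate, eval_derivative_dilate]
  ring

theorem norm_opValue_le_of_lt {n : ℕ} (hn : n ≠ 0) {F G : ℂ[X]} (hF : F.natDegree ≤ n)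
    (hG : RootsInDisc n G) (h : ∀ z : ℂ, ‖z‖ = 1 → ‖F.eval z‖ ≤ ‖G.eval z‖)
    {R : ℝ} (hR : 1 ≤ R) {lam : ℂ} (hlam : ‖lam‖ ≤ ((R + 1) / 2) ^ n)
    {a z : ℂ} (ha : ‖a‖ < 1) (hz : 1 < ‖z‖) :
    ‖opValue n a lam R F z‖ ≤ ‖opValue n a lam R G z‖ := by
  by_cases hne : R = 1 ∧ lam = 1
  · obtain ⟨rfl, rfl⟩ := hne
    simp [opValue_eq]
  · have hnz : ∀ H : ℂ[X], RootsInDisc n H → opValue n a lam R H z ≠ 0 := fun H hH =>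
      (hH.dilate_sub hn hR hlam hne).eval_smirnov_ne_zero hn ha hz
    by_contra! hlt
    have hGz := hnz G hG
    refine hnz _ (RootsInDisc.sub_C_mul hF hG h
      (μ := opValue n a lam R F z / opValue n a lam R G z) ?_) ?_
    · rw [norm_div]
      exact (one_lt_div (norm_pos_iff.2 hGz)).2 hlt
    · rw [opValue_sub_C_mul, div_mul_cancel₀ _ hGz, sub_self]

theorem norm_opValue_le {n : ℕ} {F G : ℂ[X]} (hF : F.natDegree ≤ n)
    (hG : RootsInDisc n G) (h : ∀ z : ℂ, ‖z‖ = 1 → ‖F.eval z‖ ≤ ‖G.eval z‖)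
    {R : ℝ} (hR : 1 ≤ R) {lam : ℂ} (hlam : ‖lam‖ ≤ ((R + 1) / 2) ^ n)
    {a z : ℂ} (ha : ‖a‖ ≤ 1) (hz : 1 ≤ ‖z‖) :
    ‖opValue n a lam R F z‖ ≤ ‖opValue n a lam R G z‖ := by
  rcases eq_or_ne n 0 with rfl | hn
  · rw [eq_C_of_natDegree_le_zero hF]
    simp [opValue_eq]
    positivity
  -- Replacing `a` by `(2 - t)a` and `z` by `tz` with `t` slightly above `1` makes both inequalities
  -- strict; then `t → 1`.
  have hlim : ∀ P : ℂ[X], Tendsto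
      (fun t : ℝ => ‖opValue n (((2 - t : ℝ) : ℂ) * a) lam R P ((t : ℂ) * z)‖) (𝓝[>] 1)
      (𝓝 ‖opValue n a lam R P z‖) := by
    intro P
    have hc : Continuous
        (fun t : ℝ => ‖opValue n (((2 - t : ℝ) : ℂ) * a) lam R P ((t : ℂ) * z)‖) := by
      simp only [opValue_eq]
      fun_prop
    have h1 := (hc.tendsto 1).mono_left (nhdsWithin_le_nhds (s := Set.Ioi (1 : ℝ)))
    have h2 : ((2 - 1 : ℝ) : ℂ) * a = a := by norm_num
    rwa [h2, Complex.ofReal_one, one_mul] at h1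
  refine le_of_tendsto_of_tendsto (hlim F) (hlim G) ?_
  filter_upwards [Ioo_mem_nhdsGT (show (1 : ℝ) < 2 by norm_num)] with t ht
  refine norm_opValue_le_of_lt hn hF hG h hR hlam ?_ ?_
  · rw [norm_mul, Complex.norm_real, Real.norm_of_nonneg (by linarith [ht.2])]
    nlinarith [ht.1, ht.2, norm_nonneg a]
  · rw [norm_mul, Complex.norm_real, Real.norm_of_nonneg (by linarith [ht.1])]
    nlinarith [ht.1]

/-! ### The conjugate reciprocal polynomial -/

/-- The conjugate reciprocal polynomial `z ^ n * conj (P (1 / conj z))`. -/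
noncomputable def conjReflect (n : ℕ) (P : ℂ[X]) : ℂ[X] := reflect n (P.map (starRingEnd ℂ))

theorem eval_conjReflect {n : ℕ} {P : ℂ[X]} (hP : P.natDegree ≤ n) {z : ℂ} (hz : z ≠ 0) :
    (conjReflect n P).eval z
      = (starRingEnd ℂ) (P.eval ((starRingEnd ℂ) z⁻¹)) * z ^ n := by
  rw [conjReflect, eval_reflect (natDegree_map_le.trans hP) hz]
  congr 1
  conv_lhs => rw [← Complex.conj_conj z⁻¹]
  rw [eval_map, eval₂_at_apply]

theorem norm_eval_conjReflect {n : ℕ} {P : ℂ[X]} (hP : P.natDegree ≤ n) {z : ℂ} (hz : ‖z‖ = 1) :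
    ‖(conjReflect n P).eval z‖ = ‖P.eval z‖ := by
  have hz0 : z ≠ 0 := by
    rintro rfl
    simp at hz
  rw [eval_conjReflect hP hz0, norm_mul, norm_pow, hz, one_pow, mul_one, Complex.norm_conj,
    Complex.inv_eq_conj hz, Complex.conj_conj]

theorem rootsInDisc_conjReflect {n : ℕ} {P : ℂ[X]} (hP : P.natDegree ≤ n)
    (h : ∀ z : ℂ, ‖z‖ < 1 → P.eval z ≠ 0) : RootsInDisc n (conjReflect n P) := by
  constructor
  · refine natDegree_eq_of_le_of_coeff_ne_zero
      (natDegree_reflect_le.trans (max_le le_rfl (natDegree_map_le.trans hP))) ?_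
    rw [conjReflect, coeff_reflect, revAt_le le_rfl, Nat.sub_self, coeff_map,
      coeff_zero_eq_eval_zero]
    simpa using h 0 (by simp)
  · intro z hz
    have hz0 : z ≠ 0 := norm_pos_iff.1 (by linarith)
    rw [eval_conjReflect hP hz0]
    refine mul_ne_zero ?_ (pow_ne_zero _ hz0)
    rw [Ne, map_eq_zero]
    refine h _ ?_
    rw [Complex.norm_conj, norm_inv]
    exact inv_lt_one_of_one_lt₀ hz

theorem conjReflect_sub_C (n : ℕ) (P : ℂ[X]) (μ : ℂ) :
    conjReflect n (P - C μ * 1) = conjReflect n P - C ((starRingEnd ℂ) μ) * X ^ n := by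
  rw [conjReflect, conjReflect, mul_one, Polynomial.map_sub, map_C, reflect_sub, reflect_C]

theorem norm_opValue_le_conjReflect {n : ℕ} {P : ℂ[X]} (hP : P.natDegree ≤ n)
    (h : ∀ z : ℂ, ‖z‖ < 1 → P.eval z ≠ 0)
    {R : ℝ} (hR : 1 ≤ R) {lam : ℂ} (hlam : ‖lam‖ ≤ ((R + 1) / 2) ^ n)
    {a z : ℂ} (ha : ‖a‖ ≤ 1) (hz : 1 ≤ ‖z‖) :
    ‖opValue n a lam R P z‖ ≤ ‖opValue n a lam R (conjReflect n P) z‖ :=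
  norm_opValue_le hP (rootsInDisc_conjReflect hP h)
    (fun _ hy => (norm_eval_conjReflect hP hy).ge) hR hlam ha hz

/-! ### Choice of phase and the estimate with maximum and minimum -/

theorem exists_norm_eq_one_mul_norm (u : ℂ) : ∃ e : ℂ, ‖e‖ = 1 ∧ u = ‖u‖ * e :=
  ⟨Complex.exp (u.arg * Complex.I), Complex.norm_exp_ofReal_mul_I _,
    (Complex.norm_mul_exp_arg_mul_I u).symm⟩

theorem exists_norm_sub_mul_eq (u v : ℂ) :
    ∃ ε : ℂ, ‖ε‖ = 1 ∧ ∀ s : ℝ, ‖u - s * ε * v‖ = |‖u‖ - s * ‖v‖| := by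
  obtain ⟨e, he, hu⟩ := exists_norm_eq_one_mul_norm u
  obtain ⟨e', he', hv⟩ := exists_norm_eq_one_mul_norm v
  have he0 : e' ≠ 0 := norm_pos_iff.1 (by rw [he']; exact one_pos)
  refine ⟨e / e', by rw [norm_div, he, he', div_one], fun s => ?_⟩
  have : u - s * (e / e') * v = ((‖u‖ - s * ‖v‖ : ℝ) : ℂ) * e := by
    conv_lhs => rw [hu, hv]
    push_cast
    field_simp
  rw [this, norm_mul, he, mul_one, Complex.norm_real, Real.norm_eq_abs]

theorem exists_norm_add_mul_eq (u v : ℂ) :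
    ∃ ε : ℂ, ‖ε‖ = 1 ∧ ‖u + ε * v‖ = ‖u‖ + ‖v‖ := by
  obtain ⟨ε, hε, h⟩ := exists_norm_sub_mul_eq u v
  refine ⟨ε, hε, ?_⟩
  have h1 := h (-1)
  rw [neg_one_mul, sub_neg_eq_add, abs_of_nonneg (by positivity)] at h1
  rw [← h1]
  congr 1
  push_cast
  ring

/-- `P - μ` has no zeros in the disk when `|μ| = s`, so it is dominated by its conjugate reciprocal
`Q - conj μ * z^n`. The phase of `μ` aligns the two terms of the image of the latter. -/
theorem norm_opValue_le_add_abs {n : ℕ} {P : ℂ[X]} (hP : P.natDegree ≤ n) {s : ℝ} (hs : 0 ≤ s)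
    (h : ∀ z : ℂ, ‖z‖ < 1 → ‖P.eval z‖ ≠ s)
    {R : ℝ} (hR : 1 ≤ R) {lam : ℂ} (hlam : ‖lam‖ ≤ ((R + 1) / 2) ^ n)
    {a z : ℂ} (ha : ‖a‖ ≤ 1) (hz : 1 ≤ ‖z‖) :
    ‖opValue n a lam R P z‖ ≤ s * ‖opValue n a lam R 1 z‖
      + |‖opValue n a lam R (conjReflect n P) z‖ - s * ‖opValue n a lam R (X ^ n) z‖| := by
  obtain ⟨ε, hε, heq⟩ :=
    exists_norm_sub_mul_eq (opValue n a lam R (conjReflect n P) z) (opValue n a lam R (X ^ n) z)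
  set μ : ℂ := (starRingEnd ℂ) (s * ε) with hμ
  have hμs : ‖μ‖ = s := by
    rw [hμ, Complex.norm_conj, norm_mul, hε, mul_one, Complex.norm_real, Real.norm_of_nonneg hs]
  have hdeg : (P - C μ * 1).natDegree ≤ n := by
    rw [mul_one, natDegree_sub_C]
    exact hP
  have hle := norm_opValue_le_conjReflect hdeg (fun w hw h0 => h w hw (by
    rw [eval_sub, mul_one, eval_C, sub_eq_zero] at h0
    rw [h0, hμs])) hR hlam ha hz
  rw [conjReflect_sub_C, opValue_sub_C_mul, opValue_sub_C_mul, hμ, Complex.conj_conj, ← hμ,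
    heq s] at hle
  have h1 := norm_sub_norm_le (opValue n a lam R P z) (μ * opValue n a lam R 1 z)
  rw [norm_mul, hμs] at h1
  linarith

theorem two_mul_norm_opValue_le {n : ℕ} {P : ℂ[X]} (hP : P.natDegree ≤ n)
    (h : ∀ z : ℂ, ‖z‖ < 1 → P.eval z ≠ 0)
    {R : ℝ} (hR : 1 ≤ R) {lam : ℂ} (hlam : ‖lam‖ ≤ ((R + 1) / 2) ^ n)
    {a z : ℂ} (ha : ‖a‖ ≤ 1) (hz : 1 ≤ ‖z‖) :
    2 * ‖opValue n a lam R P z‖ ≤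
      (‖opValue n a lam R (X ^ n) z‖ + ‖opValue n a lam R 1 z‖) * maxModulus P
      - (‖opValue n a lam R (X ^ n) z‖ - ‖opValue n a lam R 1 z‖) * minModulus P := by
  obtain ⟨⟨w, -, hw⟩, hmax⟩ := maxModulus_isGreatest P
  obtain ⟨⟨v, -, hv⟩, hmin⟩ := minModulus_isLeast P
  set M := maxModulus P
  set m := minModulus P
  have hM0 : 0 ≤ M := hw ▸ norm_nonneg _
  have hm0 : 0 ≤ m := hv ▸ norm_nonneg _
  have hMs : ∀ y : ℂ, ‖y‖ = 1 → ‖P.eval y‖ ≤ M := fun y hy =>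
    hmax ⟨y, mem_sphere_zero_iff_norm.2 hy, rfl⟩
  have hms : ∀ y : ℂ, ‖y‖ = 1 → m ≤ ‖P.eval y‖ := fun y hy =>
    hmin ⟨y, mem_sphere_zero_iff_norm.2 hy, rfl⟩
  have hmd : ∀ y : ℂ, ‖y‖ < 1 → m ≤ ‖P.eval y‖ := by
    intro y hy
    have := norm_eval_le_of_sphere (C (m : ℂ)) P h
      (fun y hy => by simpa [abs_of_nonneg hm0] using hms y hy) y hy.le
    simpa [abs_of_nonneg hm0] using this
  have hMpos : 0 < M := by
    refine lt_of_lt_of_le (norm_pos_iff.2 (h 0 (by simp))) ?_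
    have := Complex.norm_le_of_forall_mem_frontier_norm_le (Metric.isBounded_ball (x := (0 : ℂ)))
      (P.differentiable.diffContOnCl (s := Metric.ball 0 1)) (C := M)
      (fun y hy => hMs y (by
        rwa [frontier_ball _ one_ne_zero, mem_sphere_zero_iff_norm] at hy))
      (subset_closure (Metric.mem_ball_self one_pos))
    exact this
  have hMd : ∀ y : ℂ, ‖y‖ < 1 → ‖P.eval y‖ ≤ M := by
    intro y hy
    have := norm_eval_le_of_sphere P (C (M : ℂ)) (fun _ _ => by simpa using hMpos.ne')
      (fun y hy => by simpa [abs_of_nonneg hM0] using hMs y hy) y hy.le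
    simpa [abs_of_nonneg hM0] using this
  set Q := conjReflect n P with hQ
  have hQr : RootsInDisc n Q := rootsInDisc_conjReflect hP h
  have hlow : m * ‖opValue n a lam R (X ^ n) z‖ ≤ ‖opValue n a lam R Q z‖ := by
    have := norm_opValue_le (F := C (m : ℂ) * X ^ n) (natDegree_C_mul_X_pow_le _ _) hQr
      (fun y hy => by
        rw [hQ, norm_eval_conjReflect hP hy]
        simpa [hy, abs_of_nonneg hm0] using hms y hy) hR hlam ha hz
    rwa [opValue_C_mul, norm_mul, Complex.norm_real, Real.norm_of_nonneg hm0] at this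
  have hhigh : ‖opValue n a lam R Q z‖ ≤ M * ‖opValue n a lam R (X ^ n) z‖ := by
    have hMC : (M : ℂ) ≠ 0 := by exact_mod_cast hMpos.ne'
    have := norm_opValue_le (G := C (M : ℂ) * X ^ n) hQr.1.le
      ⟨natDegree_C_mul_X_pow _ _ hMC, fun y hy => by
        have : y ≠ 0 := norm_pos_iff.1 (by linarith)
        simp [hMC, this]⟩
      (fun y hy => by
        rw [hQ, norm_eval_conjReflect hP hy]
        simpa [hy, abs_of_nonneg hM0] using hMs y hy) hR hlam ha hz
    rwa [opValue_C_mul, norm_mul, Complex.norm_real, Real.norm_of_nonneg hM0] at this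
  -- `|P|` may take the values `m` and `M` inside the disk when `P` is constant, so `s = tm` with `t
  -- < 1` and `s = tM` with `t > 1` are used, followed by `t → 1`.
  have hlim : ∀ c : ℝ, Tendsto (fun t : ℝ => (t * c) * ‖opValue n a lam R 1 z‖
      + |‖opValue n a lam R Q z‖ - (t * c) * ‖opValue n a lam R (X ^ n) z‖|) (𝓝 1)
      (𝓝 (c * ‖opValue n a lam R 1 z‖
      + |‖opValue n a lam R Q z‖ - c * ‖opValue n a lam R (X ^ n) z‖|)) := by
    intro c
    have hc : Continuous (fun t : ℝ => (t * c) * ‖opValue n a lam R 1 z‖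
      + |‖opValue n a lam R Q z‖ - (t * c) * ‖opValue n a lam R (X ^ n) z‖|) := by fun_prop
    simpa using hc.tendsto 1
  have hm : ‖opValue n a lam R P z‖ ≤ m * ‖opValue n a lam R 1 z‖
      + |‖opValue n a lam R Q z‖ - m * ‖opValue n a lam R (X ^ n) z‖| := by
    refine ge_of_tendsto ((hlim m).mono_left (nhdsWithin_le_nhds (s := Set.Iio (1 : ℝ)))) ?_
    filter_upwards [Ioo_mem_nhdsLT (show (0 : ℝ) < 1 by norm_num)] with t ht
    refine norm_opValue_le_add_abs hP (mul_nonneg ht.1.le hm0) (fun y hy => ?_) hR hlam ha hz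
    have h1 := hmd y hy
    have h2 := norm_pos_iff.2 (h y hy)
    intro h3
    rcases hm0.eq_or_lt with h4 | h4
    · rw [← h4, mul_zero] at h3
      linarith
    · nlinarith [ht.2]
  have hM : ‖opValue n a lam R P z‖ ≤ M * ‖opValue n a lam R 1 z‖
      + |‖opValue n a lam R Q z‖ - M * ‖opValue n a lam R (X ^ n) z‖| := by
    refine ge_of_tendsto ((hlim M).mono_left (nhdsWithin_le_nhds (s := Set.Ioi (1 : ℝ)))) ?_
    filter_upwards [self_mem_nhdsWithin] with t ht
    rw [Set.mem_Ioi] at ht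
    refine norm_opValue_le_add_abs hP (by positivity) (fun y hy => ?_) hR hlam ha hz
    have h1 := hMd y hy
    intro h3
    nlinarith
  rw [abs_of_nonneg (by linarith)] at hm
  rw [abs_of_nonpos (by linarith)] at hM
  linarith

/-! ### The constants `A` and `B`, and the extremal polynomial -/

theorem eval_smirnov_X_pow (n : ℕ) (a z : ℂ) :
    (smirnov n a (X ^ n)).eval z = n * z ^ (n - 1) := by
  rw [eval_smirnov]
  cases n with
  | zero => simp
  | succ k =>
    simp
    ring

theorem norm_sub_mul_gap_le {n : ℕ} {α β : ℂ} (hα : ‖α‖ ≤ 1) (hβ : ‖β‖ ≤ 1) {R : ℝ}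
    (hR : 1 ≤ R) : ‖α - β * (gap n α R : ℂ)‖ ≤ ((R + 1) / 2) ^ n := by
  have hK : 1 ≤ ((R + 1) / 2) ^ n := one_le_pow₀ (by linarith)
  have hg : 0 ≤ gap n α R := by
    rw [gap]
    linarith
  have h1 := norm_sub_le α (β * (gap n α R : ℂ))
  rw [norm_mul, Complex.norm_real, Real.norm_of_nonneg hg] at h1
  have h2 : ‖β‖ * gap n α R ≤ gap n α R := mul_le_of_le_one_left hg hβ
  have h3 : gap n α R = ((R + 1) / 2) ^ n - ‖α‖ := rfl
  linarith

theorem coeffA_mul_norm_eq (n : ℕ) (a α β : ℂ) (R : ℝ) (z : ℂ) :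
    coeffA n α β R * ‖(smirnov n a (X ^ n)).eval z‖
      = ‖opValue n a (α - β * (gap n α R : ℂ)) R (X ^ n) z‖ := by
  rw [opValue_X_pow, eval_smirnov_X_pow, norm_mul (_ - _), coeffA, sub_add]

theorem coeffB_mul_norm_eq (n : ℕ) (a α β : ℂ) (R : ℝ) (z : ℂ) :
    coeffB n α β R * n * ‖a‖ = ‖opValue n a (α - β * (gap n α R : ℂ)) R 1 z‖ := by
  rw [opValue_one, norm_neg, norm_mul, norm_mul, Complex.norm_natCast, coeffB, sub_add]
  ring

theorem maxModulus_X_pow_add_one (n : ℕ) : maxModulus (X ^ n + 1) = 2 := by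
  refine (maxModulus_isGreatest _).unique ⟨⟨1, by simp, by norm_num⟩, ?_⟩
  rintro _ ⟨z, hz, rfl⟩
  have hz1 : ‖z‖ = 1 := by simpa using hz
  have := norm_add_le (z ^ n) 1
  simp only [norm_pow, hz1, one_pow, norm_one] at this
  simp
  linarith

theorem minModulus_X_pow_add_one {n : ℕ} (hn : n ≠ 0) : minModulus (X ^ n + 1) = 0 := by
  refine (minModulus_isLeast _).unique ⟨?_, ?_⟩
  · obtain ⟨z, hz⟩ := IsAlgClosed.exists_pow_nat_eq (-1 : ℂ) (Nat.pos_of_ne_zero hn)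
    refine ⟨z, ?_, by simp [hz]⟩
    rw [mem_sphere_zero_iff_norm, ← pow_eq_one_iff_of_nonneg (norm_nonneg z) hn, ← norm_pow, hz]
    simp
  · rintro _ ⟨z, -, rfl⟩
    exact norm_nonneg _

theorem combination_X_pow_add_one (n : ℕ) (a α β : ℂ) (R : ℝ) (z : ℂ) :
    combination n a α β R (X ^ n + 1) z
      = opValue n a (α - β * (gap n α R : ℂ)) R (X ^ n) z
        + opValue n a (α - β * (gap n α R : ℂ)) R 1 z := by
  have : (X ^ n + 1 : ℂ[X]) = X ^ n - C (-1) * 1 := by simp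
  rw [combination_eq_opValue, this, opValue_sub_C_mul]
  ring

theorem bound_X_pow_add_one (n : ℕ) (a α β : ℂ) (R : ℝ) (z : ℂ) :
    bound n a α β R (X ^ n + 1) z
      = ‖opValue n a (α - β * (gap n α R : ℂ)) R (X ^ n) z‖
        + ‖opValue n a (α - β * (gap n α R : ℂ)) R 1 z‖ := by
  rw [bound, coeffA_mul_norm_eq, coeffB_mul_norm_eq n a α β R z, maxModulus_X_pow_add_one]
  rcases eq_or_ne n 0 with rfl | hn
  · simp [opValue_eq]
  · rw [minModulus_X_pow_add_one hn]
    ring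

end Smirnov

theorem theorem2 (n : ℕ) (α β : ℂ) (hα : ‖α‖ ≤ 1) (hβ : ‖β‖ ≤ 1) (R : ℝ) (hR : 1 ≤ R) :
    -- the inequality
    (∀ (P : ℂ[X]), P.natDegree = n → (∀ z : ℂ, ‖z‖ < 1 → P.eval z ≠ 0) →
      ∀ a : ℂ, ‖a‖ ≤ 1 → ∀ z : ℂ, 1 ≤ ‖z‖ →
        ‖Smirnov.combination n a α β R P z‖ ≤ Smirnov.bound n a α β R P z) ∧
    -- equality is attained for `z ^ n + 1`, at every point `z`, with `a` of any given modulus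
    (∀ z : ℂ, 1 ≤ ‖z‖ → ∀ ρ : ℝ, 0 ≤ ρ → ρ ≤ 1 → ∃ a : ℂ, ‖a‖ = ρ ∧
      ‖Smirnov.combination n a α β R (X ^ n + 1) z‖
        = Smirnov.bound n a α β R (X ^ n + 1) z) ∧
    -- and, when `n ≥ 2`, for every `a`, at some point `z` of any given modulus
    (2 ≤ n → ∀ a : ℂ, ‖a‖ ≤ 1 → ∀ r : ℝ, 1 ≤ r → ∃ z : ℂ, ‖z‖ = r ∧
      ‖Smirnov.combination n a α β R (X ^ n + 1) z‖
        = Smirnov.bound n a α β R (X ^ n + 1) z) := by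
  refine ⟨fun P hP h0 a ha z hz => ?_, fun z _ ρ hρ0 _ => ?_, fun hn a _ r hr => ?_⟩
  · have := Smirnov.two_mul_norm_opValue_le hP.le h0 hR
      (Smirnov.norm_sub_mul_gap_le (n := n) hα hβ hR) ha hz
    rw [Smirnov.bound, Smirnov.combination_eq_opValue, Smirnov.coeffA_mul_norm_eq,
      Smirnov.coeffB_mul_norm_eq n a α β R z]
    linarith
  · set lam := α - β * (Smirnov.gap n α R : ℂ) with hlam
    -- `T[z^n]` does not depend on `a` and `T[1]` is linear in `a`, so rotating `a` aligns them.
    obtain ⟨ε, hε, h⟩ := Smirnov.exists_norm_add_mul_eq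
      (((R : ℂ) ^ n - lam) * (n * z ^ (n - 1))) (-(n * ρ * (1 - lam)))
    refine ⟨ρ * ε, by simp [hε, abs_of_nonneg hρ0], ?_⟩
    rw [Smirnov.combination_X_pow_add_one, Smirnov.bound_X_pow_add_one, ← hlam,
      Smirnov.opValue_X_pow, Smirnov.opValue_one,
      show -(n * (ρ * ε) * (1 - lam)) = ε * (-(n * ρ * (1 - lam))) by ring, h,
      norm_mul ε, hε, one_mul]
  · set lam := α - β * (Smirnov.gap n α R : ℂ) with hlam
    obtain ⟨ε, hε, h⟩ := Smirnov.exists_norm_add_mul_eq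
      (-(n * a * (1 - lam))) (((R : ℂ) ^ n - lam) * (n * r ^ (n - 1)))
    -- `T[1]` is independent of `z`, while `T[z^n]` rotates with `z^(n-1)`; this needs `n - 1 > 0`.
    obtain ⟨ζ, hζ⟩ := IsAlgClosed.exists_pow_nat_eq ε (show 0 < n - 1 by omega)
    have hζ1 : ‖ζ‖ = 1 := by
      rw [← pow_eq_one_iff_of_nonneg (norm_nonneg ζ) (show n - 1 ≠ 0 by omega), ← norm_pow, hζ, hε]
    refine ⟨r * ζ, by simp [hζ1, abs_of_nonneg (zero_le_one.trans hr)], ?_⟩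
    rw [Smirnov.combination_X_pow_add_one, Smirnov.bound_X_pow_add_one, ← hlam,
      Smirnov.opValue_X_pow, Smirnov.opValue_one, mul_pow, hζ,
      show ((R : ℂ) ^ n - lam) * (n * (r ^ (n - 1) * ε))
        = ε * (((R : ℂ) ^ n - lam) * (n * r ^ (n - 1))) by ring, add_comm, h,
      norm_mul ε, hε, one_mul, add_comm]
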